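/- Let $(R,\mathfrak m,k)$ be a commutative Noetherian local ring. For a nonzero $R$-module $M$, a *bounded quasi-injective resolution* of $M$ is a bounded complex $I=(\cdots\to I_{i+1}\to I_i\to I_{i-1}\to\cdots)$ of injective $R$-modules for which there are non-negative integers $b_i$ $(i\in\mathbb Z)$, not all zero, with $H_i(I)\cong M^{\oplus b_i}$ for all $i$. Put $\inf I=\inf\{i\mid I_i\neq 0\}$ and $\operatorname{hinf} I=\inf\{i\mid H_i(I)\neq 0\}$, and define the *quasi-injective dimension* of $M$ by $$\operatorname{qid}_R M=\inf\{\operatorname{hinf} I-\inf I\mid I \text{ is a bounded quasi-injective resolution of } M\},$$ so that $\operatorname{qid}_R M=\infty$ if and only if $M$ has no bounded quasi-injective resolution. Let $M$ be a nonzero finitely generated $R$-module. If $\operatorname{qid}_R M<\infty$, then $$\operatorname{qid}_R M=\operatorname{depth} R,$$ where $\operatorname{depth} R$ is the supremum of the lengths of the $R$-regular sequences contained in $\mathfrak m$. -/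

import Mathlib

universe v u

noncomputable section

namespace QuasiInjective

open CategoryTheory CategoryTheory.Limits

attribute [local instance] Abelian.hasFiniteBiproducts

variable {C : Type u} [Category.{v} C] [Abelian C]

/-- The complex `I` vanishes in all sufficiently large homological degrees. -/
def BoundedAbove (I : ChainComplex C ℤ) : Prop :=
  ∃ b : ℤ, ∀ i : ℤ, b < i → IsZero (I.X i)

/-- The complex `I` vanishes in all sufficiently small homological degrees. -/
def BoundedBelow (I : ChainComplex C ℤ) : Prop :=
  ∃ a : ℤ, ∀ i : ℤ, i < a → IsZero (I.X i)

/-- `inf I`, the least `i` with `I_i ≠ 0` (for a nonzero complex which is bounded below;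
see `isLeast_cinf`). -/
def cinf (I : ChainComplex C ℤ) : ℤ :=
  sInf {i : ℤ | ¬ IsZero (I.X i)}

/-- `hinf I`, the least `i` with `H_i(I) ≠ 0` (for a complex which is bounded below and not exact;
see `isLeast_hinf`). -/
def hinf (I : ChainComplex C ℤ) : ℤ :=
  sInf {i : ℤ | ¬ IsZero (I.homology i)}

/-- `I` is a quasi-injective resolution of `M`: a bounded above complex of injective objects such
that there are non-negative integers `b i`, not all zero, with `H_i(I) ≅ M^{⊕ b i}`.
(In degrees above the supremum of `I` the homology is zero, and `b i = 0` does.) -/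
structure IsQuasiInjectiveResolution (M : C) (I : ChainComplex C ℤ) : Prop where
  boundedAbove : BoundedAbove I
  injective : ∀ i : ℤ, Injective (I.X i)
  homology : ∃ b : ℤ → ℕ, (∃ i, b i ≠ 0) ∧
    ∀ i : ℤ, Nonempty (I.homology i ≅ ⨁ fun _ : Fin (b i) => M)

/-- `I` is a bounded quasi-injective resolution of `M`. -/
structure IsBoundedQuasiInjectiveResolution (M : C) (I : ChainComplex C ℤ) : Prop
    extends IsQuasiInjectiveResolution M I where
  boundedBelow : BoundedBelow I

open Classical in
/-- The quasi-injective dimension of `M`: it is `-∞` if `M = 0`, and otherwise the infimum of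
`hinf I - inf I` over the bounded quasi-injective resolutions `I` of `M` (so `∞` if there are none).
The integers `hinf I - inf I` are non-negative, see `cinf_le_hinf`. -/
def qid (M : C) : WithBot ℕ∞ :=
  if IsZero M then ⊥
  else ⨅ (I : ChainComplex C ℤ) (_ : IsBoundedQuasiInjectiveResolution M I),
    (((hinf I - cinf I).toNat : ℕ∞) : WithBot ℕ∞)

lemma isZero_homology {I : ChainComplex C ℤ} {i : ℤ} (h : IsZero (I.X i)) :
    IsZero (I.homology i) :=
  (ShortComplex.exact_iff_isZero_homology _).1 (ShortComplex.exact_of_isZero_X₂ _ h)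

lemma IsBoundedQuasiInjectiveResolution.isLeast_hinf {M : C} (hM : ¬ IsZero M)
    {I : ChainComplex C ℤ} (hI : IsBoundedQuasiInjectiveResolution M I) :
    IsLeast {i : ℤ | ¬ IsZero (I.homology i)} (hinf I) := by
  obtain ⟨a, ha⟩ := hI.boundedBelow
  obtain ⟨b, ⟨i, hi⟩, hb⟩ := hI.homology
  have hne : {i : ℤ | ¬ IsZero (I.homology i)}.Nonempty := by
    refine ⟨i, fun h => hM ?_⟩
    obtain ⟨e⟩ := hb i
    have h' : IsZero (⨁ fun _ : Fin (b i) => M) := h.of_iso e.symm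
    have j : Fin (b i) := ⟨0, Nat.pos_of_ne_zero hi⟩
    exact IsZero.of_mono (biproduct.ι (fun _ : Fin (b i) => M) j) h'
  have hbd : BddBelow {i : ℤ | ¬ IsZero (I.homology i)} :=
    ⟨a, fun k hk => not_lt.1 fun hlt => hk (isZero_homology (ha k hlt))⟩
  exact ⟨Int.csInf_mem hne hbd, fun k hk => csInf_le hbd hk⟩

lemma IsBoundedQuasiInjectiveResolution.isLeast_cinf {M : C} (hM : ¬ IsZero M)
    {I : ChainComplex C ℤ} (hI : IsBoundedQuasiInjectiveResolution M I) :
    IsLeast {i : ℤ | ¬ IsZero (I.X i)} (cinf I) := by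
  obtain ⟨a, ha⟩ := hI.boundedBelow
  have hbd : BddBelow {i : ℤ | ¬ IsZero (I.X i)} :=
    ⟨a, fun k hk => not_lt.1 fun hlt => hk (ha k hlt)⟩
  exact ⟨Int.csInf_mem ⟨hinf I, fun h => (hI.isLeast_hinf hM).1 (isZero_homology h)⟩ hbd,
    fun k hk => csInf_le hbd hk⟩

lemma IsBoundedQuasiInjectiveResolution.cinf_le_hinf {M : C} (hM : ¬ IsZero M)
    {I : ChainComplex C ℤ} (hI : IsBoundedQuasiInjectiveResolution M I) :
    cinf I ≤ hinf I :=
  (hI.isLeast_cinf hM).2 fun h => (hI.isLeast_hinf hM).1 (isZero_homology h)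

/-- The depth of a local ring `R`: the supremum of the lengths of the `R`-regular sequences
in the maximal ideal. -/
def ringDepth (R : Type u) [CommRing R] [IsLocalRing R] : ℕ∞ :=
  ⨆ (rs : List R) (_ : (∀ r ∈ rs, r ∈ IsLocalRing.maximalIdeal R) ∧
    RingTheory.Sequence.IsRegular R rs), (rs.length : ℕ∞)

end QuasiInjective

end

/-! Let `I` be a bounded quasi-injective resolution, `s = hinf I` and `Z` its cycles in degree `s`.
Below `s` the complex is exact, so `0 → Z → I_s → ⋯ → I_{inf I} → 0` is an injective resolution and
`Z` has injective dimension at most `s - inf I`. Conversely, if this dimension is at most `d`, the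
cycles in degree `s - d` are injective, and truncating there gives a resolution with `hinf - inf ≤
d`. It remains to prove Bass's formula for `Z`.

Lower bound (`length_lt_of_hasInjectiveDimensionLT`): `Z` maps onto `H_s(I)`, a nonzero finitely
generated module, and `Ext^r(R/(x₁,…,x_r), -)` is right exact and nonzero on `H_s(I)`.

Upper bound (`hasInjectiveDimensionLT_of_extFinite`): `Z` need not be finitely generated, but its
`Ext` modules in positive degrees are (`extFinite_cycles`), which is all that the Nakayama arguments
need. -/

open CategoryTheory CategoryTheory.Limits CategoryTheory.Abelian RingTheory.Sequence IsLocalRing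

noncomputable section

namespace QuasiInjective

/-! ### Vanishing and finiteness of `Ext` modules -/

section ExtModules

variable {R : Type u} [CommRing R]

lemma subsingleton_ext_of_iso {N N' X : ModuleCat.{u} R} (e : N ≅ N') {n : ℕ}
    (h : Subsingleton (Ext N X n)) : Subsingleton (Ext N' X n) := by
  refine subsingleton_of_forall_eq 0 fun x => ?_
  have hx : x = (Ext.mk₀ e.inv).comp ((Ext.mk₀ e.hom).comp x (zero_add n)) (zero_add n) := by
    simp
  rw [hx, Subsingleton.elim ((Ext.mk₀ e.hom).comp x (zero_add n)) 0, Ext.comp_zero]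

/-- Nakayama's lemma for `Ext`: if `x` is regular on `N` and `Ext^{n+1}(N/xN, X)` vanishes, then
so does the finitely generated module `Ext^n(N, X)`. -/
lemma subsingleton_ext_of_quotSMulTop [IsLocalRing R] {N X : ModuleCat.{u} R} {n : ℕ}
    [Module.Finite R (Ext N X n)] {x : R} (hx : x ∈ maximalIdeal R) (reg : IsSMulRegular N x)
    (h : Subsingleton (Ext (ModuleCat.of R (QuotSMulTop x N)) X (n + 1))) :
    Subsingleton (Ext N X n) := by
  by_contra hn
  rw [not_subsingleton_iff_nontrivial] at hn
  -- It suffices that `x` acts surjectively on `Ext^n(N, X)`; this follows from the long exact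
  -- sequence of `N → N → N/xN`.
  have hj : x ∈ (Module.annihilator R (Ext N X n)).jacobson := maximalIdeal_le_jacobson _ hx
  refine Submodule.top_ne_pointwise_smul_of_mem_jacobson_annihilator hj (Eq.symm ?_)
  rw [eq_top_iff]
  intro y _
  obtain ⟨z : Ext N X n, hz⟩ := Ext.contravariant_sequence_exact₁ reg.smulShortComplex_shortExact X y
    (add_comm 1 n) (Subsingleton.elim (α := Ext (ModuleCat.of R (QuotSMulTop x N)) X (n + 1)) _ _)
  have hz' : x • z = y := by
    rw [← hz]
    change x • z = (Ext.mk₀ (x • 𝟙 N)).comp z (zero_add n)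
    rw [Ext.mk₀_smul, Ext.smul_comp, Ext.mk₀_id_comp]
  rw [← hz']
  exact Submodule.smul_mem_pointwise_smul _ _ ⊤ trivial

/-- The vanishing of `Ext^{n+r}(N/(x₁,…,x_r)N, X)` for an `N`-regular sequence forces
that of `Ext^n(N, X)`, for finitely generated modules over a local ring. -/
lemma subsingleton_ext_of_isWeaklyRegular [IsNoetherianRing R] [IsLocalRing R]
    (X : ModuleCat.{u} R) [Module.Finite R X] (rs : List R)
    (mem : ∀ r ∈ rs, r ∈ maximalIdeal R) (N : ModuleCat.{u} R) [Module.Finite R N]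
    (reg : IsWeaklyRegular N rs) (n : ℕ)
    (h : Subsingleton (Ext (ModuleCat.of R (N ⧸ Ideal.ofList rs • (⊤ : Submodule R N))) X
      (n + rs.length))) :
    Subsingleton (Ext N X n) := by
  induction rs generalizing N n with
  | nil =>
    refine subsingleton_ext_of_iso ?_ h
    exact (Submodule.quotEquivOfEqBot _ (by simp)).toModuleIso
  | cons x rs ih =>
    simp only [List.mem_cons, forall_eq_or_imp] at mem
    rw [isWeaklyRegular_cons_iff] at reg
    refine subsingleton_ext_of_quotSMulTop mem.1 reg.1 ?_
    refine ih mem.2 (ModuleCat.of R (QuotSMulTop x N)) reg.2 (n + 1) ?_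
    rw [show n + 1 + rs.length = n + (x :: rs).length by simp; omega]
    exact subsingleton_ext_of_iso
      (Submodule.quotOfListConsSMulTopEquivQuotSMulTopInner N x rs).toModuleIso h

/-- The next term `Ext^{n+1}(N, X₁)` of the long exact sequence is zero, so `Ext^n(N, -)` is right
exact. -/
lemma subsingleton_ext_X₃_of_hasProjectiveDimensionLT {S : ShortComplex (ModuleCat.{u} R)}
    (hS : S.ShortExact) (N : ModuleCat.{u} R) (n : ℕ) [HasProjectiveDimensionLT N (n + 1)]
    (h : Subsingleton (Ext N S.X₂ n)) : Subsingleton (Ext N S.X₃ n) := by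
  refine subsingleton_of_forall_eq 0 fun x => ?_
  obtain ⟨y, rfl⟩ := Ext.covariant_sequence_exact₃ N hS x rfl
    (Ext.eq_zero_of_hasProjectiveDimensionLT _ (n + 1) le_rfl)
  rw [Subsingleton.elim y 0, Ext.zero_comp]

lemma subsingleton_ext_X₁_of_hasInjectiveDimensionLT {S : ShortComplex (ModuleCat.{u} R)}
    (hS : S.ShortExact) (X : ModuleCat.{u} R) (n : ℕ) [HasInjectiveDimensionLT X (n + 1)]
    (h : Subsingleton (Ext S.X₂ X n)) : Subsingleton (Ext S.X₁ X n) := by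
  refine subsingleton_of_forall_eq 0 fun x => ?_
  obtain ⟨y, rfl⟩ := Ext.contravariant_sequence_exact₁ hS X x (add_comm 1 n)
    (Ext.eq_zero_of_hasInjectiveDimensionLT _ (n + 1) le_rfl)
  rw [Subsingleton.elim y 0, Ext.comp_zero]

lemma subsingleton_ext_X₂ {S : ShortComplex (ModuleCat.{u} R)}
    (hS : S.ShortExact) (X : ModuleCat.{u} R) (n : ℕ)
    (h₁ : Subsingleton (Ext S.X₁ X n)) (h₃ : Subsingleton (Ext S.X₃ X n)) :
    Subsingleton (Ext S.X₂ X n) := by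
  refine subsingleton_of_forall_eq 0 fun x => ?_
  obtain ⟨y, rfl⟩ := Ext.contravariant_sequence_exact₂ hS X x (Subsingleton.elim _ _)
  rw [Subsingleton.elim y 0, Ext.comp_zero]

/-- Modules `X` such that `Ext^n(N, X)` is finitely generated for every finitely generated `N` and
every `n > 0`. -/
def ExtFinite (X : ModuleCat.{u} R) : Prop :=
  ∀ (N : ModuleCat.{u} R) (n : ℕ), Module.Finite R N → Module.Finite R (Ext N X (n + 1))

lemma extFinite_of_finite [IsNoetherianRing R] (X : ModuleCat.{u} R) [Module.Finite R X] :
    ExtFinite X := fun _ _ _ => inferInstance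

lemma extFinite_of_isZero {X : ModuleCat.{u} R} (hX : IsZero X) : ExtFinite X := fun N n _ => by
  have : Subsingleton (Ext N X (n + 1)) :=
    haveI := hX.hasInjectiveDimensionLT_zero
    HasInjectiveDimensionLT.subsingleton X 0 (n + 1) (Nat.zero_le _) N
  infer_instance

lemma ExtFinite.X₂ [IsNoetherianRing R] {S : ShortComplex (ModuleCat.{u} R)} (hS : S.ShortExact)
    (h₁ : ExtFinite S.X₁) (h₃ : ExtFinite S.X₃) : ExtFinite S.X₂ := fun N n hN => by
  have := h₁ N n hN
  have := h₃ N n hN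
  let f := (Ext.mk₀ S.f).postcompOfLinear R N (add_zero (n + 1))
  let g := (Ext.mk₀ S.g).postcompOfLinear R N (add_zero (n + 1))
  have hfg : LinearMap.ker g ≤ LinearMap.range f := fun x hx =>
    Ext.covariant_sequence_exact₂ N hS x hx
  have : Module.Finite R (LinearMap.ker g) :=
    Module.Finite.of_injective (Submodule.inclusion hfg) (Submodule.inclusion_injective hfg)
  have : Module.Finite R (Ext N S.X₂ (n + 1) ⧸ LinearMap.ker g) :=
    Module.Finite.equiv g.quotKerEquivRange.symm
  exact Module.Finite.of_submodule_quotient (LinearMap.ker g)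

/-- Dimension shifting embeds `Ext^{n+1}(N, X₃)` in `Ext^{n+2}(N, X₁)`. Degree zero must be excluded
from `ExtFinite`, since Hom into an injective need not be finitely generated. -/
lemma ExtFinite.X₃ [IsNoetherianRing R] {S : ShortComplex (ModuleCat.{u} R)} (hS : S.ShortExact)
    [Injective S.X₂] (h₁ : ExtFinite S.X₁) : ExtFinite S.X₃ := fun N n hN => by
  have := h₁ N (n + 1) hN
  refine Module.Finite.of_injective (hS.extClass.postcompOfLinear R N rfl) ?_
  rw [injective_iff_map_eq_zero]
  intro x hx
  obtain ⟨y, rfl⟩ := Ext.covariant_sequence_exact₃ N hS x rfl hx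
  rw [Ext.eq_zero_of_injective y, Ext.zero_comp]

/-- Baer's criterion for the injective dimension. -/
lemma hasInjectiveDimensionLT_of_forall_ideal (n : ℕ) (X : ModuleCat.{u} R)
    (h : ∀ I : Ideal R, Subsingleton (Ext (ModuleCat.of R (R ⧸ I)) X (n + 1))) :
    HasInjectiveDimensionLT X (n + 1) := by
  induction n generalizing X with
  | zero =>
    rw [zero_add, ← injective_iff_hasInjectiveDimensionLT_one]
    suffices Module.Baer R X from
      (Module.injective_iff_injective_object R X).1 this.injective
    intro I g
    let S : ShortComplex (ModuleCat.{u} R) :=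
      ModuleCat.shortComplexOfCompEqZero I.subtype (Submodule.mkQ I)
        (LinearMap.exact_subtype_mkQ I).linearMap_comp_eq_zero
    have hS : S.ShortExact := ModuleCat.shortComplex_shortExact S
      (LinearMap.exact_subtype_mkQ I) (Submodule.subtype_injective I) (Submodule.mkQ_surjective I)
    have : Subsingleton (Ext S.X₃ X 1) := h I
    obtain ⟨y, hy⟩ := Ext.contravariant_sequence_exact₁ hS X
      (Ext.mk₀ (ModuleCat.ofHom g : S.X₁ ⟶ X)) (add_zero 1) (Subsingleton.elim _ _)
    obtain ⟨y, rfl⟩ := (Ext.mk₀_bijective _ _).2 y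
    rw [Ext.mk₀_comp_mk₀, (Ext.mk₀_bijective _ _).1.eq_iff] at hy
    refine ⟨y.hom, fun x hx => ?_⟩
    exact congr($(hy) (⟨x, hx⟩ : I))
  | succ n ih =>
    -- Pass to the cokernel of an embedding in an injective, which shifts `Ext` down by one degree.
    let ⟨J, _, f, _⟩ := EnoughInjectives.presentation X
    have hS : (ShortComplex.mk f (cokernel.π f) (cokernel.condition f)).ShortExact :=
      { exact := ShortComplex.exact_cokernel f }
    refine (hS.hasInjectiveDimensionLT_X₃_iff n inferInstance).1 (ih _ fun I => ?_)
    refine subsingleton_of_forall_eq 0 fun x => ?_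
    have := h I
    obtain ⟨y, rfl⟩ := Ext.covariant_sequence_exact₃ _ hS x rfl (Subsingleton.elim _ _)
    rw [Ext.eq_zero_of_injective y, Ext.zero_comp]

end ExtModules

/-! ### Bass's formula over a local ring -/

section LocalRing

variable {R : Type u} [CommRing R] [IsNoetherianRing R] [IsLocalRing R]

/-- If a regular sequence `rs` cannot be prolonged, then the residue field embeds in
`R/(rs)`. -/
lemma exists_injective_residueField (rs : List R) (mem : ∀ r ∈ rs, r ∈ maximalIdeal R)
    (reg : IsRegular R rs)
    (hmax : ∀ x ∈ maximalIdeal R, ¬ IsRegular R (rs ++ [x])) :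
    ∃ f : (R ⧸ maximalIdeal R) →ₗ[R] (R ⧸ Ideal.ofList rs • (⊤ : Submodule R R)),
      Function.Injective f := by
  -- If this Hom vanished, some element of the maximal ideal would be regular on `R/(rs)` and
  -- prolong `rs`.
  have hne : ¬ Subsingleton ((R ⧸ maximalIdeal R) →ₗ[R]
      (R ⧸ Ideal.ofList rs • (⊤ : Submodule R R))) := by
    rw [IsSMulRegular.subsingleton_linearMap_iff]
    rintro ⟨x, hx, hreg⟩
    rw [Ideal.annihilator_quotient] at hx
    refine hmax x hx (IsRegular.of_isWeaklyRegular_of_mem_maximalIdeal R ?_ ?_)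
    · simpa [or_imp, forall_and] using ⟨mem, hx⟩
    · rw [isWeaklyRegular_append_iff]
      exact ⟨reg.1, by simpa using hreg⟩
  rw [not_subsingleton_iff_nontrivial] at hne
  obtain ⟨f, hf⟩ := exists_ne (0 : (R ⧸ maximalIdeal R) →ₗ[R]
      (R ⧸ Ideal.ofList rs • (⊤ : Submodule R R)))
  have : IsSimpleModule R (R ⧸ maximalIdeal R) :=
    isSimpleModule_iff_isCoatom.2 (Ideal.isMaximal_def.1 inferInstance)
  exact ⟨f, f.injective_or_eq_zero.resolve_right hf⟩

lemma hasProjectiveDimensionLT_quotient_ofList (rs : List R)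
    (mem : ∀ r ∈ rs, r ∈ maximalIdeal R) (reg : IsWeaklyRegular R rs) :
    HasProjectiveDimensionLT
      (ModuleCat.of R (R ⧸ Ideal.ofList rs • (⊤ : Submodule R R))) (rs.length + 1) := by
  have h := ModuleCat.projectiveDimension_quotient_eq_add_length_of_isWeaklyRegular
    (ModuleCat.of R R) rs reg mem
  rw [ModuleCat.projectiveDimension_eq_zero_of_projective (ModuleCat.of R R), zero_add] at h
  exact (projectiveDimension_le_iff _ _).1 h.le

/-- If `Ext^n(-, X)` is right exact (contravariantly) with finitely generated values and kills the
residue field, then it kills every finitely generated module. -/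
lemma subsingleton_ext_of_residueField {X : ModuleCat.{u} R} (hX : ExtFinite X) (n : ℕ)
    [HasInjectiveDimensionLT X (n + 2)]
    (hk : Subsingleton (Ext (ModuleCat.of R (R ⧸ maximalIdeal R)) X (n + 1)))
    (N : Type u) [AddCommGroup N] [Module R N] [hN : Module.Finite R N] :
    Subsingleton (Ext (ModuleCat.of R N) X (n + 1)) := by
  induction hN using IsNoetherianRing.induction_on_isQuotientEquivQuotientPrime R with
  | subsingleton N =>
    have : IsZero (ModuleCat.of R N) := ModuleCat.isZero_of_subsingleton _
    have := this.hasProjectiveDimensionLT_zero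
    exact HasProjectiveDimensionLT.subsingleton (ModuleCat.of R N) 0 (n + 1) (Nat.zero_le _) X
  | quotient N p e =>
    refine subsingleton_ext_of_iso e.toModuleIso.symm ?_
    by_cases hp : p.1 = maximalIdeal R
    · rw [hp]; exact hk
    -- Such an `x` is regular on the domain `R/p`, and `Ext^{n+2}(-, X) = 0`, so Nakayama applies.
    · obtain ⟨x, hx, hxp⟩ : ∃ x ∈ maximalIdeal R, x ∉ p.1 := by
        by_contra! hcon
        exact hp (le_antisymm (le_maximalIdeal p.2.ne_top) hcon)
      have := hX (ModuleCat.of R (R ⧸ p.1)) n inferInstance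
      refine subsingleton_ext_of_quotSMulTop hx ?_
        (HasInjectiveDimensionLT.subsingleton X (n + 2) (n + 2) le_rfl _)
      refine (isSMulRegular_iff_right_eq_zero_of_smul).2 fun y hy => ?_
      obtain ⟨y, rfl⟩ := Ideal.Quotient.mk_surjective y
      rw [Ideal.Quotient.eq_zero_iff_mem]
      have : x * y ∈ p.1 := by
        rw [← Ideal.Quotient.eq_zero_iff_mem]
        exact hy
      exact (p.2.mem_or_mem this).resolve_left hxp
  | exact N₁ N₂ N₃ f g hf hg hfg h₁ h₃ =>
    let S : ShortComplex (ModuleCat.{u} R) :=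
      ModuleCat.shortComplexOfCompEqZero f g hfg.linearMap_comp_eq_zero
    exact subsingleton_ext_X₂ (S := S) (ModuleCat.shortComplex_shortExact S hfg hf hg) X (n + 1)
      h₁ h₃

/-- **Bass's formula**, upper bound: a module of finite injective dimension with finitely generated
`Ext` modules has injective dimension at most the length of any maximal regular sequence. -/
lemma hasInjectiveDimensionLT_of_extFinite {X : ModuleCat.{u} R} (hX : ExtFinite X)
    (rs : List R) (mem : ∀ r ∈ rs, r ∈ maximalIdeal R) (reg : IsRegular R rs)
    (hmax : ∀ x ∈ maximalIdeal R, ¬ IsRegular R (rs ++ [x]))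
    (n : ℕ) (hn : HasInjectiveDimensionLT X n) :
    HasInjectiveDimensionLT X (rs.length + 1) := by
  induction n with
  | zero => exact hasInjectiveDimensionLT_of_ge X 0 _ (Nat.zero_le _)
  | succ n ih =>
    by_cases hle : n ≤ rs.length
    · exact hasInjectiveDimensionLT_of_ge X (n + 1) _ (by omega)
    obtain ⟨n, rfl⟩ : ∃ m, n = m + 1 := ⟨n - 1, by omega⟩
    refine ih (hasInjectiveDimensionLT_of_forall_ideal n X fun I =>
      subsingleton_ext_of_residueField hX n ?_ (R ⧸ I))
    -- In the top degree `n + 1`, `Ext(R/(rs), X)` surjects onto `Ext(k, X)`; it vanishes because `n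
    -- + 1` exceeds the projective dimension of `R/(rs)`.
    obtain ⟨f, hf⟩ := exists_injective_residueField rs mem reg hmax
    let S : ShortComplex (ModuleCat.{u} R) :=
      ModuleCat.shortComplexOfCompEqZero f (LinearMap.range f).mkQ
        f.exact_map_mkQ_range.linearMap_comp_eq_zero
    have hS : S.ShortExact := ModuleCat.shortComplex_shortExact S
      f.exact_map_mkQ_range hf (Submodule.mkQ_surjective _)
    have := hasProjectiveDimensionLT_quotient_ofList rs mem reg.1
    exact subsingleton_ext_X₁_of_hasInjectiveDimensionLT hS X (n + 1)
      (HasProjectiveDimensionLT.subsingleton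
        (ModuleCat.of R (R ⧸ Ideal.ofList rs • (⊤ : Submodule R R))) (rs.length + 1) (n + 1)
        (by omega) X)

/-- **Bass's formula**, lower bound: if `X` surjects onto a nonzero finitely generated module, then
its injective dimension is at least the length of any regular sequence. -/
lemma length_lt_of_hasInjectiveDimensionLT {S : ShortComplex (ModuleCat.{u} R)}
    (hS : S.ShortExact) [Module.Finite R S.X₃] (h₃ : ¬ IsZero S.X₃)
    (rs : List R) (mem : ∀ r ∈ rs, r ∈ maximalIdeal R) (reg : IsWeaklyRegular R rs)
    (n : ℕ) [HasInjectiveDimensionLT S.X₂ n] : rs.length < n := by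
  by_contra! hle
  have := hasProjectiveDimensionLT_quotient_ofList rs mem reg
  have h := subsingleton_ext_X₃_of_hasProjectiveDimensionLT hS
    (ModuleCat.of R (R ⧸ Ideal.ofList rs • (⊤ : Submodule R R))) rs.length
    (HasInjectiveDimensionLT.subsingleton S.X₂ n _ hle _)
  have h0 : Subsingleton (Ext (ModuleCat.of R R) S.X₃ 0) :=
    subsingleton_ext_of_isWeaklyRegular S.X₃ rs mem (ModuleCat.of R R) reg 0
      (by rw [zero_add]; exact h)
  have h1 : Subsingleton (R →ₗ[R] S.X₃) :=
    ((Ext.addEquiv₀ (X := ModuleCat.of R R) (Y := S.X₃)).trans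
      ModuleCat.homAddEquiv).symm.subsingleton
  have h2 : Subsingleton S.X₃ := (LinearMap.ringLmapEquivSelf R R S.X₃).symm.subsingleton
  exact h₃ (ModuleCat.isZero_of_subsingleton _)

end LocalRing

/-! ### Cycles and truncations of complexes of injectives -/

section Complexes

variable {C : Type u} [Category.{v} C] [Abelian C]

/-- The short complex `B_i ⟶ Z_i ⟶ H_i` of boundaries, cycles and homology. -/
abbrev boundariesCyclesHomology (K : ChainComplex C ℤ) (i : ℤ) : ShortComplex C :=
  ShortComplex.mk (kernel.ι (K.homologyπ i)) (K.homologyπ i) (kernel.condition _)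

lemma boundariesCyclesHomology_shortExact (K : ChainComplex C ℤ) (i : ℤ) :
    (boundariesCyclesHomology K i).ShortExact where
  exact := ShortComplex.exact_kernel _

/-- The short complex `Z_{i+1} ⟶ K_{i+1} ⟶ B_i`. -/
abbrev cyclesObjBoundaries (K : ChainComplex C ℤ) (i : ℤ) : ShortComplex C :=
  ShortComplex.mk (K.iCycles (i + 1))
    (kernel.lift (K.homologyπ i) (K.toCycles (i + 1) i) (by simp))
    (by
      rw [← cancel_mono (kernel.ι (K.homologyπ i)), ← cancel_mono (K.iCycles i)]
      simp)

lemma cyclesObjBoundaries_shortExact (K : ChainComplex C ℤ) (i : ℤ) :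
    (cyclesObjBoundaries K i).ShortExact where
  exact := by
    refine ShortComplex.exact_of_f_is_kernel _
      (KernelFork.IsLimit.ofι _ _ (fun {A} k hk => K.liftCycles k i (by simp) ?_)
        (fun {A} k hk => by simp) (fun {A} k hk m hm => ?_))
    · have h : k ≫ kernel.lift (K.homologyπ i) (K.toCycles (i + 1) i) (by simp) ≫
          kernel.ι _ ≫ K.iCycles i = 0 := by
        rw [← Category.assoc, hk, zero_comp]
      simpa using h
    · rw [← cancel_mono (K.iCycles (i + 1))]
      simpa using hm
  epi_g := by
    let T := ShortComplex.mk (K.toCycles (i + 1) i) (K.homologyπ i) (by simp)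
    have hT : T.Exact := T.exact_of_g_is_cokernel (K.homologyIsCokernel (i + 1) i (by simp))
    exact hT.epi_kernelLift

lemma isZero_cycles {K : ChainComplex C ℤ} {i : ℤ} (h : IsZero (K.X i)) : IsZero (K.cycles i) :=
  IsZero.of_mono (K.iCycles i) h

lemma isIso_kernel_ι_homologyπ {K : ChainComplex C ℤ} {i : ℤ} (h : IsZero (K.homology i)) :
    IsIso (kernel.ι (K.homologyπ i)) := by
  rw [h.eq_zero_of_tgt (K.homologyπ i)]
  infer_instance

/-- One step up in an exact part of a complex of injectives. -/
lemma hasInjectiveDimensionLT_cycles_succ {K : ChainComplex C ℤ} {i : ℤ}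
    (hinj : Injective (K.X (i + 1))) (h : IsZero (K.homology i)) {n : ℕ}
    (hn : HasInjectiveDimensionLT (K.cycles i) n) :
    HasInjectiveDimensionLT (K.cycles (i + 1)) (n + 1) := by
  have := isIso_kernel_ι_homologyπ h
  refine (cyclesObjBoundaries_shortExact K i).hasInjectiveDimensionLT_X₁ n ?_ ?_
  · exact hasInjectiveDimensionLT_of_iso (asIso (kernel.ι (K.homologyπ i))).symm n
  · exact hasInjectiveDimensionLT_of_ge (K.X (i + 1)) 1 (n + 1) (by omega)

/-- One step down in an exact part of a complex of injectives. -/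
lemma hasInjectiveDimensionLT_cycles_pred {K : ChainComplex C ℤ} {i : ℤ}
    (hinj : Injective (K.X (i + 1))) (h : IsZero (K.homology i)) {n : ℕ}
    (hn : HasInjectiveDimensionLT (K.cycles (i + 1)) (n + 2)) :
    HasInjectiveDimensionLT (K.cycles i) (n + 1) := by
  have := isIso_kernel_ι_homologyπ h
  have := ((cyclesObjBoundaries_shortExact K i).hasInjectiveDimensionLT_X₃_iff n hinj).2 hn
  exact hasInjectiveDimensionLT_of_iso (asIso (kernel.ι (K.homologyπ i))) (n + 1)

lemma hasInjectiveDimensionLT_cycles_add {K : ChainComplex C ℤ} (hinj : ∀ i, Injective (K.X i))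
    {a : ℤ} (ha : IsZero (K.X a)) (n : ℕ)
    (hH : ∀ i, i < a + n → IsZero (K.homology i)) :
    HasInjectiveDimensionLT (K.cycles (a + n)) n := by
  induction n with
  | zero =>
    rw [Nat.cast_zero, add_zero]
    exact (isZero_cycles ha).hasInjectiveDimensionLT_zero
  | succ n ih =>
    rw [Nat.cast_succ, ← add_assoc]
    push_cast at hH
    exact hasInjectiveDimensionLT_cycles_succ (hinj _) (hH _ (by omega))
      (ih fun i hi => hH i (by omega))

/-- Below `s`, cycles one degree lower are a cosyzygy, so each step down lowers the bound on the
injective dimension by one. -/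
lemma injective_cycles_sub {K : ChainComplex C ℤ} (hinj : ∀ i, Injective (K.X i))
    (n : ℕ) {s : ℤ} (hH : ∀ i, i < s → IsZero (K.homology i))
    (hs : HasInjectiveDimensionLT (K.cycles s) (n + 1)) :
    Injective (K.cycles (s - n)) := by
  induction n generalizing s with
  | zero =>
    rw [Nat.cast_zero, sub_zero]
    exact injective_iff_hasInjectiveDimensionLT_one.2 hs
  | succ n ih =>
    have h := ih (s := s - 1) (fun i hi => hH i (by omega))
      (hasInjectiveDimensionLT_cycles_pred (hinj _) (hH _ (by omega)) (by simpa using hs))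
    rwa [show s - 1 - (n : ℤ) = s - ((n + 1 : ℕ) : ℤ) by push_cast; ring] at h

/-- The embedding of `down ℕ` in `down ℤ` sending `n` to `a + n`. -/
def embeddingDownIntGE (a : ℤ) :
    ComplexShape.Embedding (ComplexShape.down ℕ) (ComplexShape.down ℤ) :=
  ComplexShape.Embedding.mk' _ _ (fun n => a + n) (fun _ _ h => by simpa using h)
    (fun i j => by simp only [ComplexShape.down_Rel]; omega)

lemma embeddingDownIntGE_f (a : ℤ) (n : ℕ) : (embeddingDownIntGE a).f n = a + n := rfl

instance (a : ℤ) : (embeddingDownIntGE a).IsTruncLE where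
  rel' i j h := by
    simp only [ComplexShape.down_Rel, embeddingDownIntGE_f] at h ⊢
    omega
  mem_prev {i j} h := ⟨j + 1, by
    simp only [ComplexShape.down_Rel, embeddingDownIntGE_f] at h ⊢
    push_cast
    omega⟩

/-- The truncation `⋯ ⟶ K_{a+2} ⟶ K_{a+1} ⟶ Z_a ⟶ 0`. -/
abbrev truncation (K : ChainComplex C ℤ) (a : ℤ) : ChainComplex C ℤ :=
  K.truncLE (embeddingDownIntGE a)

lemma isZero_truncation_X (K : ChainComplex C ℤ) (a : ℤ) {i : ℤ} (hi : i < a) :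
    IsZero ((truncation K a).X i) :=
  (truncation K a).isZero_X_of_isStrictlySupported (embeddingDownIntGE a) i fun n hn => by
    rw [embeddingDownIntGE_f] at hn
    omega

lemma truncation_X_self (K : ChainComplex C ℤ) (a : ℤ) :
    Nonempty ((truncation K a).X a ≅ K.cycles a) :=
  ⟨K.truncLEXIsoCycles (embeddingDownIntGE a) (i := 0) (by simp [embeddingDownIntGE_f])
    ((embeddingDownIntGE a).boundaryLE (k' := a - 1) (by simp [embeddingDownIntGE_f])
      fun n hn => by
        rw [embeddingDownIntGE_f] at hn
        omega)⟩

lemma truncation_X_of_lt (K : ChainComplex C ℤ) {a i : ℤ} (hi : a < i) :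
    Nonempty ((truncation K a).X i ≅ K.X i) := by
  obtain ⟨n, rfl⟩ : ∃ n : ℕ, i = a + ((n + 1 : ℕ) : ℤ) :=
    ⟨(i - a - 1).toNat, by push_cast; omega⟩
  exact ⟨K.truncLEXIso (embeddingDownIntGE a) (i := n + 1) rfl
    ((embeddingDownIntGE a).not_boundaryLE_prev (j := n) (by simp))⟩

lemma truncation_homology (K : ChainComplex C ℤ) {a : ℤ}
    (hH : ∀ i, i < a → IsZero (K.homology i)) (i : ℤ) :
    Nonempty ((truncation K a).homology i ≅ K.homology i) := by
  rcases lt_or_ge i a with hi | hi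
  · exact ⟨(isZero_homology (isZero_truncation_X K a hi)).iso (hH i hi)⟩
  · have : QuasiIsoAt (K.ιTruncLE (embeddingDownIntGE a)) i :=
      K.quasiIsoAt_ιTruncLE (embeddingDownIntGE a) (j := (i - a).toNat)
        (by rw [embeddingDownIntGE_f]; omega)
    exact ⟨isoOfQuasiIsoAt (K.ιTruncLE (embeddingDownIntGE a)) i⟩

lemma hinf_truncation (K : ChainComplex C ℤ) {a : ℤ}
    (hH : ∀ i, i < a → IsZero (K.homology i)) : hinf (truncation K a) = hinf K := by
  unfold hinf
  congr 1
  ext i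
  obtain ⟨e⟩ := truncation_homology K hH i
  exact not_congr e.isZero_iff

/-- Truncating a quasi-injective resolution at an injective module of cycles gives a quasi-injective
resolution. -/
lemma IsBoundedQuasiInjectiveResolution.truncation {M : C} {I : ChainComplex C ℤ}
    (hI : IsBoundedQuasiInjectiveResolution M I) {a : ℤ}
    (hH : ∀ i, i < a → IsZero (I.homology i)) (ha : Injective (I.cycles a)) :
    IsBoundedQuasiInjectiveResolution M (truncation I a) where
  boundedAbove := by
    obtain ⟨b, hb⟩ := hI.boundedAbove
    refine ⟨max a b, fun i hi => ?_⟩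
    obtain ⟨e⟩ := truncation_X_of_lt I (a := a) (i := i) (by omega)
    exact (hb i (by omega)).of_iso e
  injective i := by
    rcases lt_trichotomy i a with hi | rfl | hi
    · have := (isZero_truncation_X I a hi).hasInjectiveDimensionLT_zero
      infer_instance
    · obtain ⟨e⟩ := truncation_X_self I i
      exact Injective.of_iso e.symm ha
    · obtain ⟨e⟩ := truncation_X_of_lt I hi
      exact Injective.of_iso e.symm (hI.injective i)
  homology := by
    obtain ⟨b, hb, hiso⟩ := hI.homology
    refine ⟨b, hb, fun i => ?_⟩
    obtain ⟨e⟩ := hiso i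
    obtain ⟨e'⟩ := truncation_homology I hH i
    exact ⟨e' ≪≫ e⟩
  boundedBelow := ⟨a, fun _ hi => isZero_truncation_X I a hi⟩

lemma IsBoundedQuasiInjectiveResolution.hasInjectiveDimensionLT_cycles_hinf {M : C}
    {I : ChainComplex C ℤ} (hM : ¬ IsZero M)
    (hI : IsBoundedQuasiInjectiveResolution M I) :
    HasInjectiveDimensionLT (I.cycles (hinf I)) ((hinf I - cinf I).toNat + 1) := by
  have hle := hI.cinf_le_hinf hM
  -- Counting starts one degree below `cinf I`, where the cycles are zero; hence the `+ 1`.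
  have ha : IsZero (I.X (cinf I - 1)) := by
    by_contra h
    have := (hI.isLeast_cinf hM).2 h
    omega
  have hs : cinf I - 1 + (((hinf I - cinf I).toNat + 1 : ℕ) : ℤ) = hinf I := by
    push_cast; omega
  have h := hasInjectiveDimensionLT_cycles_add hI.injective ha ((hinf I - cinf I).toNat + 1)
    (fun i hi => by
      by_contra h
      have := (hI.isLeast_hinf hM).2 h
      omega)
  rwa [hs] at h

end Complexes

/-! ### The two bounds for quasi-injective resolutions of modules -/

section Modules

variable {R : Type u} [CommRing R]

lemma IsBoundedQuasiInjectiveResolution.finite_homology {M : ModuleCat.{u} R} [Module.Finite R M]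
    {I : ChainComplex (ModuleCat.{u} R) ℤ} (hI : IsBoundedQuasiInjectiveResolution M I) (i : ℤ) :
    Module.Finite R (I.homology i) := by
  obtain ⟨b, -, hb⟩ := hI.homology
  obtain ⟨e⟩ := hb i
  exact Module.Finite.equiv
    (e ≪≫ ModuleCat.biproductIsoPi fun _ : Fin (b i) => M).toLinearEquiv.symm

variable [IsNoetherianRing R]

/-- The modules of cycles of a bounded above complex of injectives with finitely generated homology
have finitely generated `Ext` modules. -/
lemma extFinite_cycles {K : ChainComplex (ModuleCat.{u} R) ℤ} (hb : BoundedAbove K)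
    (hinj : ∀ i, Injective (K.X i)) (hfin : ∀ i, Module.Finite R (K.homology i)) (i : ℤ) :
    ExtFinite (K.cycles i) := by
  obtain ⟨b, hb⟩ := hb
  -- Descending induction on the degree, from above `b`, where the cycles vanish.
  suffices ∀ n : ℕ, ∀ i : ℤ, b < i + n → ExtFinite (K.cycles i) from
    this (b - i + 1).toNat i (by omega)
  intro n
  induction n with
  | zero => exact fun i hi => extFinite_of_isZero (isZero_cycles (hb i (by simpa using hi)))
  | succ n ih =>
    intro i hi
    have hB : ExtFinite (boundariesCyclesHomology K i).X₁ :=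
      have : Injective (cyclesObjBoundaries K i).X₂ := hinj (i + 1)
      ExtFinite.X₃ (cyclesObjBoundaries_shortExact K i) (ih (i + 1) (by push_cast at hi; omega))
    have := hfin i
    exact ExtFinite.X₂ (boundariesCyclesHomology_shortExact K i) hB
      (extFinite_of_finite (K.homology i))

variable [IsLocalRing R] {M : ModuleCat.{u} R} [Module.Finite R M]
  {I : ChainComplex (ModuleCat.{u} R) ℤ}

lemma IsBoundedQuasiInjectiveResolution.length_le (hM : ¬ IsZero M)
    (hI : IsBoundedQuasiInjectiveResolution M I) (rs : List R)
    (mem : ∀ r ∈ rs, r ∈ maximalIdeal R) (reg : IsRegular R rs) :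
    rs.length ≤ (hinf I - cinf I).toNat := by
  have := hI.finite_homology (hinf I)
  have := hI.hasInjectiveDimensionLT_cycles_hinf hM
  exact Nat.lt_succ_iff.1 (length_lt_of_hasInjectiveDimensionLT
    (boundariesCyclesHomology_shortExact I (hinf I)) (hI.isLeast_hinf hM).1 rs mem reg.1 _)

lemma IsBoundedQuasiInjectiveResolution.exists_le_length (hM : ¬ IsZero M)
    (hI : IsBoundedQuasiInjectiveResolution M I) (rs : List R)
    (mem : ∀ r ∈ rs, r ∈ maximalIdeal R) (reg : IsRegular R rs)
    (hmax : ∀ x ∈ maximalIdeal R, ¬ IsRegular R (rs ++ [x])) :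
    ∃ J : ChainComplex (ModuleCat.{u} R) ℤ, IsBoundedQuasiInjectiveResolution M J ∧
      (hinf J - cinf J).toNat ≤ rs.length := by
  have hH : ∀ i, i < hinf I → IsZero (I.homology i) := fun i hi => by
    by_contra h
    have := (hI.isLeast_hinf hM).2 h
    omega
  have hid : HasInjectiveDimensionLT (I.cycles (hinf I)) (rs.length + 1) :=
    hasInjectiveDimensionLT_of_extFinite
      (extFinite_cycles hI.boundedAbove hI.injective hI.finite_homology (hinf I))
      rs mem reg hmax _ (hI.hasInjectiveDimensionLT_cycles_hinf hM)
  have hH' : ∀ i, i < hinf I - rs.length → IsZero (I.homology i) :=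
    fun i hi => hH i (by omega)
  have hJ := hI.truncation hH' (injective_cycles_sub hI.injective rs.length hH hid)
  refine ⟨_, hJ, ?_⟩
  -- Only an inequality: the cycles at the truncation degree may be zero.
  have hc : hinf I - rs.length ≤ cinf (QuasiInjective.truncation I (hinf I - rs.length)) := by
    by_contra! hlt
    exact (hJ.isLeast_cinf hM).1 (isZero_truncation_X I _ hlt)
  rw [hinf_truncation I hH']
  omega

end Modules

end QuasiInjective

end

open QuasiInjective

theorem theorem3p2 {R : Type u} [CommRing R] [IsNoetherianRing R] [IsLocalRing R]
    (M : Type u) [AddCommGroup M] [Module R M] [Module.Finite R M] [Nontrivial M]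
    (hM : QuasiInjective.qid (ModuleCat.of R M) < ⊤) :
    QuasiInjective.qid (ModuleCat.of R M) = (QuasiInjective.ringDepth R : WithBot ℕ∞) := by
  have hM0 : ¬ IsZero (ModuleCat.of R M) := by
    rw [ModuleCat.isZero_iff_subsingleton]
    exact not_subsingleton M
  rw [qid, if_neg hM0] at hM ⊢
  obtain ⟨I, hI⟩ : ∃ I, IsBoundedQuasiInjectiveResolution (ModuleCat.of R M) I := by
    by_contra! hcon
    simp [hcon] at hM
  let P : ℕ → Prop := fun n => ∃ rs : List R, ((∀ r ∈ rs, r ∈ maximalIdeal R) ∧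
    IsRegular R rs) ∧ rs.length = n
  obtain ⟨d, ⟨rs, ⟨mem, reg⟩, hlen⟩, hd⟩ : ∃ d, P d ∧ ∀ n, P n → n ≤ d := by
    classical
    -- The given resolution already bounds the lengths of regular sequences, so the supremum
    -- defining the depth is attained.
    have hbd : ∀ n, P n → n ≤ (hinf I - cinf I).toNat := by
      rintro _ ⟨rs, ⟨mem, reg⟩, rfl⟩
      exact hI.length_le hM0 rs mem reg
    have h0 : P 0 := ⟨[], ⟨by simp, IsRegular.nil R R⟩, rfl⟩
    exact ⟨_, Nat.findGreatest_spec (Nat.zero_le _) h0,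
      fun n hn => Nat.le_findGreatest (hbd n hn) hn⟩
  have hdepth : ringDepth R = d := by
    refine le_antisymm (iSup₂_le fun rs' h => ?_) ?_
    · exact_mod_cast hd _ ⟨rs', h, rfl⟩
    · rw [← hlen]
      exact le_iSup₂_of_le (f := fun (rs : List R) (_ : (∀ r ∈ rs, r ∈ maximalIdeal R) ∧
        IsRegular R rs) => (rs.length : ℕ∞)) rs ⟨mem, reg⟩ le_rfl
  rw [hdepth]
  refine le_antisymm ?_ (le_iInf₂ fun J hJ => ?_)
  · obtain ⟨J, hJ, hle⟩ := hI.exists_le_length hM0 rs mem reg fun x hx hreg => by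
      have := hd _ ⟨rs ++ [x], ⟨by simpa [or_imp, forall_and] using ⟨mem, hx⟩, hreg⟩, rfl⟩
      simp [hlen] at this
    refine iInf₂_le_of_le J hJ ?_
    rw [hlen] at hle
    exact_mod_cast hle
  · have := hJ.length_le hM0 rs mem reg
    rw [hlen] at this
    exact_mod_cast this
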